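/- Let $A$ be a $W^*$-algebra, i.e. a (complex, not necessarily unital) $C^*$-algebra for which there are a Banach space $A_*$ and an isometric linear isomorphism $j : A \to (A_*)'$ onto the normed dual of $A_*$. Fix any such $A_*$ and $j$, and let the weak-$*$ topology on $A$ be $\mathcal T_{w^*} = \{\, j^{-1}(O) : O \in \sigma((A_*)', A_*) \,\}$. Then for every $a \in A$ the translations $x \mapsto ax$ and $x \mapsto xa$ are continuous as maps $(A, \mathcal T_{w^*}) \to (A, \mathcal T_{w^*})$. -/

import Mathlib

open Topology

/-- Let `A` be a C⋆-algebra (not assumed unital), `X` a complex Banach space and `j : A → X'` an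
isometric linear isomorphism of `A` onto the normed dual of `X`, so that `A` is a W⋆-algebra with
predual `X`. The weak-⋆ topology on `A` is the initial topology with respect to `j`, where `X'`
carries its weak-⋆ topology `σ(X', X)`. -/
@[reducible]
noncomputable def wStarTopology {A X : Type*} [NonUnitalCStarAlgebra A]
    [NormedAddCommGroup X] [NormedSpace ℂ X] [CompleteSpace X]
    (j : A ≃ₗᵢ[ℂ] StrongDual ℂ X) : TopologicalSpace A :=
  TopologicalSpace.induced (fun x : A => StrongDual.toWeakDual (j x))
    (inferInstance : TopologicalSpace (WeakDual ℂ X))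

/-! A translation is weak-⋆ continuous once its transpose leaves the predual invariant. By
`exists_eq_eval_of_tendsto_closedBall` this only needs continuity at 0 on the unit ball, and by
linearity only for self-adjoint `a`. Let x → 0 weak-⋆ along an ultrafilter on the ball, and let Φ(T)
be the limit of T x. For functions b, c on the spectrum of `a`, put φ(b, c) = c(a) Φ(b(a)). If bc =
0 then φ(b, c) = 0: left multiplications by b(a) and c(a) have orthogonal ranges, and the norm is
weak-⋆ lower semicontinuous (`apply_map_eq_zero_of_mul_eq_zero`). A bounded bilinear map that kills
zero products satisfies φ(g, 1) = φ(1, g), so Φ(a) = a Φ(1) = 0. Right translations follow in the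
opposite algebra. -/

open Filter Metric

/-! ### Piecewise linear partitions of unity. -/

/-- The retraction of the real line onto the unit interval. -/
noncomputable def unitClamp (t : ℝ) : ℝ := max 0 (min 1 t)

lemma unitClamp_nonneg (t : ℝ) : 0 ≤ unitClamp t := le_max_left _ _

lemma unitClamp_of_nonpos {t : ℝ} (h : t ≤ 0) : unitClamp t = 0 :=
  max_eq_left ((min_le_right _ _).trans h)

lemma unitClamp_of_one_le {t : ℝ} (h : 1 ≤ t) : unitClamp t = 1 := by
  simp [unitClamp, min_eq_left h]

lemma unitClamp_mono {s t : ℝ} (h : s ≤ t) : unitClamp s ≤ unitClamp t :=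
  max_le_max le_rfl (min_le_min le_rfl h)

lemma continuous_unitClamp : Continuous unitClamp := by
  unfold unitClamp; fun_prop

lemma sum_unitClamp (y : ℝ) (n : ℕ) :
    ∑ k ∈ Finset.range n, unitClamp (y - k) = max 0 (min (n : ℝ) y) := by
  induction n with
  | zero => simp
  | succ n ih =>
    rw [Finset.sum_range_succ, ih, unitClamp]
    have hn : (0 : ℝ) ≤ n := n.cast_nonneg
    push_cast
    rcases le_total y n with h1 | h1 <;> rcases le_total y 0 with h2 | h2 <;>
      rcases le_total y (n + 1) with h3 | h3 <;>
      simp only [max_def, min_def] <;> split_ifs <;> linarith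

/-- The tent function of height one with support `[k - 1, k + 1]`. -/
noncomputable def tent (k : ℕ) (y : ℝ) : ℝ := unitClamp (y - k + 1) - unitClamp (y - k)

lemma continuous_tent (k : ℕ) : Continuous (tent k) := by
  have := continuous_unitClamp
  unfold tent; fun_prop

lemma tent_nonneg (k : ℕ) (y : ℝ) : 0 ≤ tent k y :=
  sub_nonneg.2 (unitClamp_mono (by linarith))

lemma tent_eq_zero_of_le {k : ℕ} {y : ℝ} (h : y ≤ k - 1) : tent k y = 0 := by
  rw [tent, unitClamp_of_nonpos (by linarith), unitClamp_of_nonpos (by linarith), sub_zero]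

lemma tent_eq_zero_of_ge {k : ℕ} {y : ℝ} (h : k + 1 ≤ y) : tent k y = 0 := by
  rw [tent, unitClamp_of_one_le (by linarith), unitClamp_of_one_le (by linarith), sub_self]

lemma tent_mul_tent_of_lt {k l : ℕ} (h : k + 2 ≤ l) (y : ℝ) : tent k y * tent l y = 0 := by
  have h' : (k : ℝ) + 2 ≤ l := by exact_mod_cast h
  rcases le_total y (k + 1) with hy | hy
  · rw [tent_eq_zero_of_le (k := l) (by linarith), mul_zero]
  · rw [tent_eq_zero_of_ge hy, zero_mul]

lemma sum_tent {n : ℕ} {y : ℝ} (h0 : 0 ≤ y) (hn : y ≤ n) :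
    ∑ k ∈ Finset.range (n + 1), tent k y = 1 := by
  have h (k : ℕ) : tent k y = unitClamp (y - k + 1) - unitClamp (y - (k + 1 : ℕ) + 1) := by
    rw [tent]; push_cast; ring_nf
  simp_rw [h]
  rw [Finset.sum_range_sub', unitClamp_of_one_le (by simpa using h0),
    unitClamp_of_nonpos (by push_cast; linarith), sub_zero]

lemma sum_mul_tent {n : ℕ} {y : ℝ} (h0 : 0 ≤ y) (hn : y ≤ n) :
    ∑ k ∈ Finset.range (n + 1), k * tent k y = y := by
  have key (m : ℕ) : ∑ k ∈ Finset.range (m + 1), k * tent k y =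
      ∑ k ∈ Finset.range m, unitClamp (y - k) - m * unitClamp (y - m) := by
    induction m with
    | zero => simp
    | succ m ih =>
      rw [Finset.sum_range_succ, ih, Finset.sum_range_succ, tent]
      have : y - ((m + 1 : ℕ) : ℝ) + 1 = y - m := by push_cast; ring
      rw [this]; push_cast; ring
  rw [key, sum_unitClamp, unitClamp_of_nonpos (by linarith), min_eq_right hn, max_eq_right h0]
  simp

/-! ### Bilinear maps that vanish on zero products. -/

section ZeroProduct

variable {K V : Type*} [TopologicalSpace K] [CompactSpace K] [NormedAddCommGroup V]
  [NormedSpace ℝ V]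

/-- The representative in `{-1, 0, 1}` of a residue class modulo three. -/
def residueSign (r : ZMod 3) : ℝ := if r = 1 then 1 else if r = -1 then -1 else 0

lemma abs_residueSign_le (r : ZMod 3) : |residueSign r| ≤ 1 := by
  unfold residueSign; split_ifs <;> simp

/-- Tents h_k at scale 1/n satisfy ∑ h_k = 1 and ∑ k h_k = n g, so the n-fold difference is ∑ (k -
l) φ(h_k, h_l). Only |k - l| ≤ 1 survives, where k - l depends on residues mod 3 alone; grouping by
residues leaves nine terms, each at most C, whatever n is. -/
lemma norm_map_sub_map_le_of_zeroProduct (φ : C(K, ℝ) →ₗ[ℝ] C(K, ℝ) →ₗ[ℝ] V) {C : ℝ} (hC0 : 0 ≤ C)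
    (hC : ∀ b c, ‖φ b c‖ ≤ C * ‖b‖ * ‖c‖)
    (hφ : ∀ b c : C(K, ℝ), (∀ x, c x ∈ Set.Icc 0 1) → b * c = 0 → φ b c = 0)
    (g : C(K, ℝ)) (hg : ∀ x, g x ∈ Set.Icc 0 1) (n : ℕ) :
    n * ‖φ g 1 - φ 1 g‖ ≤ 9 * C := by
  have hn0 : (0 : ℝ) ≤ n := n.cast_nonneg
  let h (k : ℕ) : C(K, ℝ) := ⟨fun x => tent k (n * g x), (continuous_tent k).comp (by fun_prop)⟩
  have hy0 (x : K) : 0 ≤ n * g x := mul_nonneg hn0 (hg x).1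
  have hyn (x : K) : n * g x ≤ n := mul_le_of_le_one_right hn0 (hg x).2
  have hsum : ∑ k ∈ Finset.range (n + 1), h k = 1 := by
    ext x; simpa [h, ContinuousMap.sum_apply] using sum_tent (hy0 x) (hyn x)
  have hsum' : ∑ k ∈ Finset.range (n + 1), (k : ℝ) • h k = (n : ℝ) • g := by
    ext x; simpa [h, ContinuousMap.sum_apply] using sum_mul_tent (hy0 x) (hyn x)
  have hnn (k : ℕ) (x : K) : 0 ≤ h k x := tent_nonneg k _
  have hpartial (s : Finset ℕ) (hs : s ⊆ Finset.range (n + 1)) (x : K) :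
      (∑ k ∈ s, h k) x ≤ 1 := by
    calc (∑ k ∈ s, h k) x ≤ (∑ k ∈ Finset.range (n + 1), h k) x := by
          simp only [ContinuousMap.sum_apply]
          exact Finset.sum_le_sum_of_subset_of_nonneg hs fun _ _ _ => hnn _ _
      _ = 1 := by rw [hsum]; rfl
  have hle (k : ℕ) (hk : k ∈ Finset.range (n + 1)) (x : K) : h k x ∈ Set.Icc 0 1 :=
    ⟨hnn k x, by simpa using hpartial {k} (by simpa using hk) x⟩
  let u (r : ZMod 3) : C(K, ℝ) := ∑ k ∈ Finset.range (n + 1) with ((k : ℕ) : ZMod 3) = r, h k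
  have hu (r : ZMod 3) : ‖u r‖ ≤ 1 := by
    rw [ContinuousMap.norm_le _ zero_le_one]
    intro x
    rw [Real.norm_eq_abs, abs_of_nonneg]
    · exact hpartial _ (Finset.filter_subset _ _) x
    · simp only [u, ContinuousMap.sum_apply]
      exact Finset.sum_nonneg fun _ _ => hnn _ _
  have hterm (k l : ℕ) (hl : l ∈ Finset.range (n + 1)) :
      ((k : ℝ) - l) • φ (h k) (h l) =
        residueSign ((k : ZMod 3) - l) • φ (h k) (h l) := by
    rcases Nat.lt_or_ge (k + 1) l with hkl | hkl
    · rw [hφ _ _ (hle l hl) (by ext x; exact tent_mul_tent_of_lt hkl _)]; simp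
    rcases Nat.lt_or_ge (l + 1) k with hlk | hlk
    · rw [hφ _ _ (hle l hl)
        (by ext x; exact (mul_comm _ _).trans (tent_mul_tent_of_lt hlk _))]; simp
    congr 1
    obtain rfl | rfl | rfl : l = k ∨ l = k + 1 ∨ k = l + 1 := by omega
    · simp [residueSign]
    · simp [residueSign, show (-1 : ZMod 3) ≠ 1 by decide]
    · simp [residueSign]
  have hexp : (n : ℝ) • (φ g 1 - φ 1 g) =
      ∑ r : ZMod 3, ∑ s : ZMod 3, residueSign (r - s) • φ (u r) (u s) := by
    have e1 : (n : ℝ) • (φ g 1 - φ 1 g) = φ ((n : ℝ) • g) 1 - φ 1 ((n : ℝ) • g) := by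
      simp [smul_sub]
    have e2 : ∑ r : ZMod 3, ∑ s : ZMod 3, residueSign (r - s) • φ (u r) (u s) =
        ∑ k ∈ Finset.range (n + 1), ∑ l ∈ Finset.range (n + 1),
          residueSign ((k : ZMod 3) - l) • φ (h k) (h l) := by
      rw [← Finset.sum_fiberwise (Finset.range (n + 1)) (fun k : ℕ => (k : ZMod 3))]
      refine Finset.sum_congr rfl fun r _ => ?_
      rw [Finset.sum_comm' (t' := Finset.range (n + 1))
        (s' := fun _ => (Finset.range (n + 1)).filter fun k : ℕ => (k : ZMod 3) = r) (by tauto),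
        ← Finset.sum_fiberwise (Finset.range (n + 1)) (fun k : ℕ => (k : ZMod 3))]
      refine Finset.sum_congr rfl fun s _ => ?_
      simp only [u, map_sum, LinearMap.sum_apply, Finset.smul_sum]
      refine Finset.sum_congr rfl fun l hl => Finset.sum_congr rfl fun k hk => ?_
      rw [(Finset.mem_filter.1 hl).2, (Finset.mem_filter.1 hk).2]
    rw [e1, e2, ← hsum', ← hsum]
    simp only [map_sum, LinearMap.sum_apply, map_smul, LinearMap.smul_apply, Finset.smul_sum]
    rw [← Finset.sum_sub_distrib, Finset.sum_comm (γ := ℕ)]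
    refine Finset.sum_congr rfl fun l hl => ?_
    rw [← Finset.sum_sub_distrib]
    refine Finset.sum_congr rfl fun k _ => ?_
    rw [← sub_smul, hterm k l hl]
  calc n * ‖φ g 1 - φ 1 g‖ = ‖(n : ℝ) • (φ g 1 - φ 1 g)‖ := by simp [norm_smul]
    _ ≤ ∑ _r : ZMod 3, ∑ _s : ZMod 3, C := by
      rw [hexp]
      refine norm_sum_le_of_le _ fun r _ => norm_sum_le_of_le _ fun s _ => ?_
      rw [norm_smul]
      calc ‖residueSign (r - s)‖ * ‖φ (u r) (u s)‖ ≤ 1 * (C * 1 * 1) := by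
            gcongr
            · exact abs_residueSign_le _
            · refine (hC _ _).trans ?_
              gcongr
              · exact hu r
              · exact hu s
        _ = C := by ring
    _ = 9 * C := by simp; ring

lemma map_one_right_eq_map_one_left_of_zeroProduct (φ : C(K, ℝ) →ₗ[ℝ] C(K, ℝ) →ₗ[ℝ] V) {C : ℝ}
    (hC0 : 0 ≤ C) (hC : ∀ b c, ‖φ b c‖ ≤ C * ‖b‖ * ‖c‖)
    (hφ : ∀ b c : C(K, ℝ), (∀ x, c x ∈ Set.Icc 0 1) → b * c = 0 → φ b c = 0)
    (g : C(K, ℝ)) : φ g 1 = φ 1 g := by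
  have unit_case (f : C(K, ℝ)) (hf : ∀ x, f x ∈ Set.Icc 0 1) : φ f 1 = φ 1 f := by
    by_contra hne
    have hpos : 0 < ‖φ f 1 - φ 1 f‖ := norm_pos_iff.2 (sub_ne_zero.2 hne)
    obtain ⟨n, hn⟩ := exists_nat_gt (9 * C / ‖φ f 1 - φ 1 f‖)
    rw [div_lt_iff₀ hpos] at hn
    exact hn.not_ge (norm_map_sub_map_le_of_zeroProduct φ hC0 hC hφ f hf n)
  let m : ℝ := ‖g‖ + 1
  have hm : 0 < m := by positivity
  let f : C(K, ℝ) := (2 * m)⁻¹ • (g + m • 1)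
  have hf (x : K) : f x ∈ Set.Icc 0 1 := by
    have hx := abs_le.1 (g.norm_coe_le_norm x)
    have hfx : f x = (g x + m) / (2 * m) := by simp [f]; field_simp
    rw [hfx]
    constructor
    · exact div_nonneg (by linarith) (by positivity)
    · rw [div_le_one (by positivity)]; linarith
  have hg : g = (2 * m) • f - m • 1 := by
    simp only [f]; rw [smul_inv_smul₀ (by positivity)]; abel
  rw [hg]
  simp only [map_sub, map_smul, LinearMap.sub_apply, LinearMap.smul_apply, unit_case f hf]

end ZeroProduct

/-! ### Recognising elements of the predual. -/

section Predual

variable {X : Type*} [NormedAddCommGroup X] [NormedSpace ℂ X]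

/-- A weak-star neighbourhood of the origin contains the annihilator of a finite set. -/
lemma WeakDual.exists_finset_annihilator_subset {W : Set (WeakDual ℂ X)} (hW : W ∈ 𝓝 0) :
    ∃ s : Finset X, ∀ f : WeakDual ℂ X, (∀ x ∈ s, f x = 0) → f ∈ W := by
  obtain ⟨s, r, hr, hs⟩ := ((WeakDual.withSeminorms ℂ X).mem_nhds_iff 0 W).1 hW
  refine ⟨s, fun f hf => hs ?_⟩
  rw [Seminorm.mem_ball, sub_zero]
  exact Seminorm.finset_sup_apply_lt hr fun x hx => by simpa [hf x hx] using hr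

/-- A functional on the dual of a Banach space whose restriction to the unit ball is weak-star
continuous at the origin is the evaluation at a point. -/
lemma exists_eq_eval_of_tendsto_closedBall [CompleteSpace X]
    (F : StrongDual ℂ (StrongDual ℂ X))
    (hF : Tendsto (fun f : WeakDual ℂ X => F (WeakDual.toStrongDual f))
      (𝓝[WeakDual.toStrongDual ⁻¹' closedBall 0 1] 0) (𝓝 0)) :
    ∃ x : X, ∀ f : StrongDual ℂ X, F f = f x := by
  let ι := NormedSpace.inclusionInDoubleDualLi (E := X) ℂ
  have hclosed : IsClosed (Set.range ι) := ι.isometry.isUniformInducing.isComplete_range.isClosed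
  suffices F ∈ closure (Set.range ι) by
    obtain ⟨x, hx⟩ := hclosed.closure_eq ▸ this
    exact ⟨x, fun f => by rw [← hx]; rfl⟩
  refine (Metric.mem_closure_iff (α := StrongDual ℂ (StrongDual ℂ X))).2 fun ε hε => ?_
  obtain ⟨W, hW, hWF⟩ := mem_nhdsWithin_iff_exists_mem_nhds_inter.1
    (hF (Metric.closedBall_mem_nhds 0 (half_pos hε)))
  obtain ⟨s, hs⟩ := WeakDual.exists_finset_annihilator_subset hW
  let e (x : s) : StrongDual ℂ X →ₗ[ℂ] ℂ := (ι x).toLinearMap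
  let N : Submodule ℂ (StrongDual ℂ X) := ⨅ x, LinearMap.ker (e x)
  have hN (f : StrongDual ℂ X) (hf : f ∈ N) (x : X) (hx : x ∈ s) : f x = 0 :=
    (Submodule.mem_iInf _).1 hf ⟨x, hx⟩
  have hbound (f : N) : ‖F f‖ ≤ ε / 2 * ‖(f : StrongDual ℂ X)‖ := by
    rcases eq_or_ne (f : StrongDual ℂ X) 0 with h0 | h0
    · simp [h0]
    have hpos : 0 < ‖(f : StrongDual ℂ X)‖ := norm_pos_iff.2 h0
    have hmem := @hWF (StrongDual.toWeakDual
      ((‖(f : StrongDual ℂ X)‖⁻¹ : ℂ) • (f : StrongDual ℂ X)))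
      ⟨hs _ fun x hx => by
        change (‖(f : StrongDual ℂ X)‖⁻¹ : ℂ) * (f : StrongDual ℂ X) x = 0
        rw [hN f f.2 x hx, mul_zero], by
        simp [norm_smul, inv_mul_cancel₀ hpos.ne']⟩
    have : ‖(f : StrongDual ℂ X)‖⁻¹ * ‖F f‖ ≤ ε / 2 := by
      simpa [norm_smul] using hmem
    rwa [inv_mul_le_iff₀ hpos, mul_comm] at this
  -- Hahn–Banach: F is small on the annihilator N of `s`, so it has a small extension G, and F - G
  -- kills N, hence is a combination of evaluations at points of `s`.
  obtain ⟨G, hG, hGn⟩ := exists_extension_norm_eq N (F.comp N.subtypeL)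
  have hGle : ‖G‖ ≤ ε / 2 := by
    rw [hGn]
    exact ContinuousLinearMap.opNorm_le_bound _ (half_pos hε).le hbound
  have hker : ⨅ x, LinearMap.ker (e x) ≤ LinearMap.ker (F - G).toLinearMap := by
    intro f hf
    have := hG ⟨f, hf⟩
    simp only [LinearMap.mem_ker, ContinuousLinearMap.coe_coe, sub_apply]
    rw [this]; simp
  have hspan := mem_span_of_iInf_ker_le_ker hker
  obtain ⟨y, hy⟩ : ∃ y : X, (ι y).toLinearMap = (F - G).toLinearMap := by
    have hle : Submodule.span ℂ (Set.range e) ≤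
        LinearMap.range ((ContinuousLinearMap.coeLM ℂ).comp ι.toLinearMap) :=
      Submodule.span_le.2 (by rintro _ ⟨x, rfl⟩; exact ⟨x, rfl⟩)
    exact hle hspan
  refine ⟨ι y, ⟨y, rfl⟩, ?_⟩
  have hy' : ι y = F - G := by
    ext f; exact DFunLike.congr_fun hy f
  have hFG : F - ι y = G := by
    rw [hy']; ext f; simp
  calc dist F (ι y) = ‖F - ι y‖ := dist_eq_norm (E := StrongDual ℂ (StrongDual ℂ X)) F (ι y)
    _ = ‖G‖ := by rw [hFG]
    _ < ε := by linarith

end Predual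

/-! ### Weak-⋆ limits along ultrafilters. -/

section Limit

variable {A X : Type*} [NormedAddCommGroup A] [NormedSpace ℂ A]
  [NormedAddCommGroup X] [NormedSpace ℂ X] (j : A ≃ₗᵢ[ℂ] StrongDual ℂ X)

lemma exists_tendsto_toWeakDual_of_forall_norm_le (𝒰 : Ultrafilter A) {f : A → A} {C : ℝ}
    (hf : ∀ᶠ x in (𝒰 : Filter A), ‖f x‖ ≤ C) :
    ∃ y : A, Tendsto (fun x => StrongDual.toWeakDual (j (f x))) 𝒰
      (𝓝 (StrongDual.toWeakDual (j y))) := by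
  obtain ⟨y, -, hy⟩ := (WeakDual.isCompact_closedBall (0 : StrongDual ℂ X) C).ultrafilter_le_nhds'
    (𝒰.map fun x => StrongDual.toWeakDual (j (f x)))
    (Ultrafilter.mem_map.2 (hf.mono fun x hx => by simpa using hx))
  refine ⟨j.symm (WeakDual.toStrongDual y), ?_⟩
  rw [j.apply_symm_apply]
  exact hy

lemma norm_le_of_tendsto_toWeakDual {l : Filter A} [l.NeBot] {f : A → A} {C : ℝ} {y : A}
    (hf : ∀ᶠ x in l, ‖f x‖ ≤ C)
    (hy : Tendsto (fun x => StrongDual.toWeakDual (j (f x))) l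
      (𝓝 (StrongDual.toWeakDual (j y)))) : ‖y‖ ≤ C := by
  have := (WeakDual.isClosed_closedBall (0 : StrongDual ℂ X) C).mem_of_tendsto hy
    (by
      filter_upwards [hf] with x hx
      simpa using hx)
  simpa using this

/-- Along an ultrafilter on the unit ball, the weak-star limits of the images of the variable
under bounded operators form a linear map, and limits of translates obey the norm bounds. -/
lemma exists_weakStarLimit_linearMap (𝒰 : Ultrafilter A) (h𝒰 : closedBall (0 : A) 1 ∈ 𝒰) :
    ∃ Φ : (A →L[ℝ] A) →ₗ[ℝ] A,
      (∀ T, Tendsto (fun x => StrongDual.toWeakDual (j (T x))) 𝒰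
        (𝓝 (StrongDual.toWeakDual (j (Φ T))))) ∧
      ∀ T y C, (∀ x, ‖x‖ ≤ 1 → ‖T x + y‖ ≤ C) → ‖Φ T + y‖ ≤ C := by
  have hball : ∀ᶠ x in (𝒰 : Filter A), ‖x‖ ≤ 1 := by
    filter_upwards [h𝒰] with x hx
    simpa using hx
  have hex (T : A →L[ℝ] A) := exists_tendsto_toWeakDual_of_forall_norm_le j 𝒰 (f := T) (C := ‖T‖)
    (hball.mono fun x hx => (T.le_opNorm x).trans (mul_le_of_le_one_right (norm_nonneg _) hx))
  choose Φ hΦ using hex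
  have hinj {y z : A} (h : StrongDual.toWeakDual (j y) = StrongDual.toWeakDual (j z)) : y = z :=
    j.injective (StrongDual.toWeakDual.injective h)
  refine ⟨{ toFun := Φ, map_add' := fun S T => ?_, map_smul' := fun r T => ?_ }, hΦ, ?_⟩
  · refine hinj (tendsto_nhds_unique (hΦ (S + T)) ?_)
    simpa using (hΦ S).add (hΦ T)
  · refine hinj (tendsto_nhds_unique (hΦ (r • T)) ?_)
    simpa [← Complex.coe_smul] using (hΦ T).const_smul (r : ℂ)
  · intro T y C h
    refine norm_le_of_tendsto_toWeakDual j (l := 𝒰) (f := fun x => T x + y)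
      (hball.mono h) ?_
    simpa using (hΦ T).add_const (StrongDual.toWeakDual (j y))

end Limit

/-! ### Orthogonality survives weak-⋆ limits. -/

section Pythagoras

variable {A K : Type*} [NormedAddCommGroup A] [NormedSpace ℝ A] [TopologicalSpace K]
  [CompactSpace K]

lemma apply_map_eq_zero_of_mul_eq_zero (π : C(K, ℝ) →ₗ[ℝ] A →L[ℝ] A)
    (hmul : ∀ g h x, π (g * h) x = π g (π h x)) (hone : π 1 = 1)
    (hnorm : ∀ g x, ‖π g x‖ ≤ ‖g‖ * ‖x‖)
    (horth : ∀ g h : C(K, ℝ), g * h = 0 → ∀ x y,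
      ‖π g x + π h y‖ ^ 2 ≤ ‖π g x‖ ^ 2 + ‖π h y‖ ^ 2)
    (Φ : (A →L[ℝ] A) →ₗ[ℝ] A)
    (hΦ : ∀ T y C, (∀ x, ‖x‖ ≤ 1 → ‖T x + y‖ ≤ C) → ‖Φ T + y‖ ≤ C)
    {b c : C(K, ℝ)} (hc : ∀ x, c x ∈ Set.Icc 0 1) (hbc : b * c = 0) : π c (Φ (π b)) = 0 := by
  set y := Φ (π b)
  set e := π c y
  have key (t : ℝ) (ht : 0 ≤ t) : (1 + t) ^ 2 * ‖e‖ ^ 2 ≤ ‖b‖ ^ 2 + t ^ 2 * ‖e‖ ^ 2 := by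
    have hpos (x : K) : 0 < 1 + t * c x := by
      have := mul_nonneg ht (hc x).1
      linarith
    -- A contraction that sends y + t e to (1 + t) e, bounding ‖y + t e‖ from below.
    let r : C(K, ℝ) := ⟨fun x => (1 + t) * c x / (1 + t * c x),
      Continuous.div (by fun_prop) (by fun_prop) fun x => (hpos x).ne'⟩
    have hr : ‖r‖ ≤ 1 := by
      rw [ContinuousMap.norm_le _ zero_le_one]
      intro x
      have h0 := (hc x).1
      have h1 := (hc x).2
      change |(1 + t) * c x / (1 + t * c x)| ≤ 1
      rw [abs_of_nonneg (div_nonneg (by positivity) (hpos x).le), div_le_one (hpos x)]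
      linarith
    have hrc : r * (1 + t • c) = (1 + t) • c := by
      ext x
      exact div_mul_cancel₀ _ (hpos x).ne'
    have h1 : (1 + t) * ‖e‖ ≤ ‖y + t • e‖ := by
      have : π r (y + t • e) = (1 + t) • e := by
        have := congrArg (fun g => π g y) hrc
        simpa only [hmul, map_add, map_smul, hone, add_apply,
          smul_apply, one_apply_eq_self] using this
      calc (1 + t) * ‖e‖ = ‖π r (y + t • e)‖ := by
            rw [this, norm_smul, Real.norm_of_nonneg (by linarith)]
        _ ≤ ‖r‖ * ‖y + t • e‖ := hnorm _ _
        _ ≤ ‖y + t • e‖ := mul_le_of_le_one_left (norm_nonneg _) hr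
    have h2 : ‖y + t • e‖ ≤ √(‖b‖ ^ 2 + t ^ 2 * ‖e‖ ^ 2) := by
      refine hΦ _ _ _ fun x hx => Real.le_sqrt_of_sq_le ?_
      have hte : t • e = π c (t • y) := (map_smul (π c) t y).symm
      calc ‖π b x + t • e‖ ^ 2 ≤ ‖π b x‖ ^ 2 + ‖t • e‖ ^ 2 := by
            rw [hte]; exact horth b c hbc _ _
        _ ≤ ‖b‖ ^ 2 + t ^ 2 * ‖e‖ ^ 2 := by
            rw [norm_smul, mul_pow, Real.norm_eq_abs, sq_abs]
            gcongr
            exact (hnorm b x).trans (mul_le_of_le_one_right (norm_nonneg _) hx)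
    rw [← mul_pow]
    exact (Real.le_sqrt (by positivity) (by positivity)).1 (h1.trans h2)
  by_contra hne
  have hpos : 0 < ‖e‖ ^ 2 := by positivity
  -- `key` says (1 + 2t)‖e‖² ≤ ‖b‖², which fails for this t.
  have := key (‖b‖ ^ 2 / ‖e‖ ^ 2) (by positivity)
  have h3 : ‖b‖ ^ 2 / ‖e‖ ^ 2 * ‖e‖ ^ 2 = ‖b‖ ^ 2 := div_mul_cancel₀ _ hpos.ne'
  nlinarith [sq_nonneg ‖b‖]

end Pythagoras

/-! ### Functional calculus in the multiplier algebra. -/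

section Multiplier

open DoubleCentralizer
open scoped MultiplierAlgebra

variable {A : Type*} [NonUnitalCStarAlgebra A]

lemma DoubleCentralizer.star_fst_mul_fst (b c : 𝓜(ℂ, A)) (x y : A) :
    star (b.fst x) * c.fst y = star x * (star b * c).fst y := by
  have h := (star b).central (star x) (c.fst y)
  rw [star_snd, star_star] at h
  exact h

/-- In the C⋆-identity for the sum, the cross terms contain `star b * c` or its adjoint. -/
lemma DoubleCentralizer.norm_fst_add_fst_sq_le {b c : 𝓜(ℂ, A)} (h : star b * c = 0) (x y : A) :
    ‖b.fst x + c.fst y‖ ^ 2 ≤ ‖b.fst x‖ ^ 2 + ‖c.fst y‖ ^ 2 := by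
  have h' : star c * b = 0 := by simpa using congrArg star h
  simp only [sq, ← CStarRing.norm_star_mul_self]
  have : star (b.fst x + c.fst y) * (b.fst x + c.fst y) =
      star (b.fst x) * b.fst x + star (c.fst y) * c.fst y := by
    rw [star_add, add_mul, mul_add, mul_add, star_fst_mul_fst b c, star_fst_mul_fst c b, h, h']
    simp
  rw [this]
  exact norm_add_le _ _

lemma DoubleCentralizer.norm_fst_apply_le (b : 𝓜(ℂ, A)) (x : A) : ‖b.fst x‖ ≤ ‖b‖ * ‖x‖ := by
  rw [← norm_fst]
  exact b.fst.le_opNorm x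

/-- A linear map on operators which obeys the norm bounds of translates commutes with left
multiplication by self-adjoint elements. -/
lemma map_mul_eq_mul_map_one_of_isSelfAdjoint (Φ : (A →L[ℝ] A) →ₗ[ℝ] A)
    (hΦ : ∀ T y C, (∀ x, ‖x‖ ≤ 1 → ‖T x + y‖ ≤ C) → ‖Φ T + y‖ ≤ C) {a : A}
    (ha : IsSelfAdjoint a) : Φ (ContinuousLinearMap.mul ℝ A a) = a * Φ 1 := by
  -- `A` may lack a unit; its multiplier algebra has one and still acts on `A`.
  have ha' : IsSelfAdjoint (a : 𝓜(ℂ, A)) := ha.map (coeHom (𝕜 := ℂ) (A := A))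
  let ψ := cfcHom (R := ℝ) ha'
  let π : C(spectrum ℝ (a : 𝓜(ℂ, A)), ℝ) →ₗ[ℝ] A →L[ℝ] A :=
    { toFun := fun g => (ψ g).fst.restrictScalars ℝ
      map_add' := fun g h => by ext x; simp
      map_smul' := fun r g => by ext x; simp }
  have hπ (g x) : π g x = (ψ g).fst x := rfl
  have hmul (g h x) : π (g * h) x = π g (π h x) := by simp [hπ]
  have hone : π 1 = 1 := by ext x; simp [hπ]
  have hnorm (g x) : ‖π g x‖ ≤ ‖g‖ * ‖x‖ := by
    rw [hπ, ← norm_cfcHom (a : 𝓜(ℂ, A)) g ha']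
    exact norm_fst_apply_le _ _
  have horth (g h : C(spectrum ℝ (a : 𝓜(ℂ, A)), ℝ)) (hgh : g * h = 0) (x y : A) :
      ‖π g x + π h y‖ ^ 2 ≤ ‖π g x‖ ^ 2 + ‖π h y‖ ^ 2 := by
    refine norm_fst_add_fst_sq_le ?_ x y
    rw [← map_star, star_trivial, ← map_mul, hgh, map_zero]
  have hΦnorm (g : C(spectrum ℝ (a : 𝓜(ℂ, A)), ℝ)) : ‖Φ (π g)‖ ≤ ‖g‖ := by
    simpa using hΦ (π g) 0 ‖g‖ fun x hx => by
      simpa using (hnorm g x).trans (mul_le_of_le_one_right (norm_nonneg _) hx)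
  let φ : C(spectrum ℝ (a : 𝓜(ℂ, A)), ℝ) →ₗ[ℝ] C(spectrum ℝ (a : 𝓜(ℂ, A)), ℝ) →ₗ[ℝ] A :=
    LinearMap.mk₂ ℝ (fun b c => π c (Φ (π b))) (by simp) (by simp) (by simp) (by simp)
  have key := map_one_right_eq_map_one_left_of_zeroProduct φ zero_le_one
    (fun b c => by
      calc ‖π c (Φ (π b))‖ ≤ ‖c‖ * ‖Φ (π b)‖ := hnorm _ _
        _ ≤ ‖c‖ * ‖b‖ := by gcongr; exact hΦnorm b
        _ = 1 * ‖b‖ * ‖c‖ := by ring)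
    (fun b c hc hbc => apply_map_eq_zero_of_mul_eq_zero π hmul hone hnorm horth Φ hΦ hc hbc)
    ((ContinuousMap.id ℝ).restrict (spectrum ℝ (a : 𝓜(ℂ, A))))
  have hid : ψ ((ContinuousMap.id ℝ).restrict (spectrum ℝ (a : 𝓜(ℂ, A)))) = (a : 𝓜(ℂ, A)) :=
    cfcHom_id ha'
  have hπid : π ((ContinuousMap.id ℝ).restrict (spectrum ℝ (a : 𝓜(ℂ, A)))) =
      ContinuousLinearMap.mul ℝ A a := by
    ext x
    rw [hπ, hid]; simp
  simpa [φ, hone, hπid] using key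

end Multiplier

/-! ### Invariance of the predual and continuity. -/

section Main

variable {A X : Type*} [NonUnitalCStarAlgebra A] [NormedAddCommGroup X] [NormedSpace ℂ X]
  (j : A ≃ₗᵢ[ℂ] StrongDual ℂ X)

/-- Left translation by a self-adjoint element is weak-star continuous at the origin on the unit
ball. -/
lemma tendsto_mul_left_closedBall {a : A} (ha : IsSelfAdjoint a) :
    Tendsto (fun f : WeakDual ℂ X =>
        StrongDual.toWeakDual (j (a * j.symm (WeakDual.toStrongDual f))))
      (𝓝[WeakDual.toStrongDual ⁻¹' closedBall 0 1] 0) (𝓝 0) := by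
  rw [tendsto_iff_ultrafilter]
  intro 𝒱 h𝒱
  let 𝒰 : Ultrafilter A := 𝒱.map fun f => j.symm (WeakDual.toStrongDual f)
  have h𝒰 : closedBall (0 : A) 1 ∈ 𝒰 := by
    refine Ultrafilter.mem_map.2 (mem_of_superset (h𝒱 self_mem_nhdsWithin) fun f hf => ?_)
    simpa using hf
  obtain ⟨Φ, hlim, hΦ⟩ := exists_weakStarLimit_linearMap j 𝒰 h𝒰
  have hone : Φ 1 = 0 := by
    have h1 : Tendsto (fun f : WeakDual ℂ X => f) 𝒱
        (𝓝 (StrongDual.toWeakDual (j (Φ 1)))) := by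
      simpa [𝒰, tendsto_map'_iff, Function.comp_def] using hlim 1
    have h2 : Tendsto (fun f : WeakDual ℂ X => f) 𝒱 (𝓝 0) :=
      h𝒱.trans nhdsWithin_le_nhds
    simpa using tendsto_nhds_unique h1 h2
  have := hlim (ContinuousLinearMap.mul ℝ A a)
  rw [map_mul_eq_mul_map_one_of_isSelfAdjoint Φ hΦ ha, hone] at this
  simpa [𝒰, tendsto_map'_iff, Function.comp_def] using this

variable [CompleteSpace X]

lemma exists_predual_mul_left_of_isSelfAdjoint {a : A} (ha : IsSelfAdjoint a) (ξ : X) :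
    ∃ η : X, ∀ x : A, j (a * x) ξ = j x η := by
  let F : StrongDual ℂ (StrongDual ℂ X) :=
    (NormedSpace.inclusionInDoubleDual ℂ X ξ).comp
      ((j : A →L[ℂ] StrongDual ℂ X).comp
        ((ContinuousLinearMap.mul ℂ A a).comp (j.symm : StrongDual ℂ X →L[ℂ] A)))
  have hF (f : StrongDual ℂ X) : F f = j (a * j.symm f) ξ := rfl
  obtain ⟨η, hη⟩ := exists_eq_eval_of_tendsto_closedBall F
    (((WeakDual.eval_continuous ξ).tendsto 0).comp (tendsto_mul_left_closedBall j ha))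
  exact ⟨η, fun x => by simpa [hF] using hη (j x)⟩

/-- The predual is invariant under the transposes of left translations. -/
lemma exists_predual_mul_left (a : A) (ξ : X) : ∃ η : X, ∀ x : A, j (a * x) ξ = j x η := by
  obtain ⟨η₁, h₁⟩ := exists_predual_mul_left_of_isSelfAdjoint j (realPart a).2 ξ
  obtain ⟨η₂, h₂⟩ := exists_predual_mul_left_of_isSelfAdjoint j (imaginaryPart a).2 ξ
  refine ⟨η₁ + Complex.I • η₂, fun x => ?_⟩
  conv_lhs => rw [← realPart_add_I_smul_imaginaryPart a]
  simp [add_mul, smul_mul_assoc, h₁, h₂]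

/-- The predual is invariant under the transposes of right translations. -/
lemma exists_predual_mul_right (a : A) (ξ : X) : ∃ η : X, ∀ x : A, j (x * a) ξ = j x η := by
  let jop : Aᵐᵒᵖ ≃ₗᵢ[ℂ] StrongDual ℂ X :=
    { (MulOpposite.opLinearEquiv ℂ (M := A)).symm.trans j.toLinearEquiv with
      norm_map' := fun x => j.norm_map x.unop }
  obtain ⟨η, hη⟩ := exists_predual_mul_left jop (MulOpposite.op a) ξ
  exact ⟨η, fun x => hη (MulOpposite.op x)⟩

lemma continuous_wStarTopology_of_forall_exists_predual {T : A → A}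
    (hT : ∀ ξ : X, ∃ η : X, ∀ x : A, j (T x) ξ = j x η) :
    Continuous[wStarTopology j, wStarTopology j] T := by
  let _ := wStarTopology j
  refine continuous_induced_rng.2 (WeakDual.continuous_of_continuous_eval fun ξ => ?_)
  obtain ⟨η, hη⟩ := hT ξ
  have : Continuous fun x : A => (StrongDual.toWeakDual (j x) : WeakDual ℂ X) η :=
    (WeakDual.eval_continuous η).comp continuous_induced_dom
  exact this.congr fun x => (hη x).symm

end Main

theorem mainTheorem5 {A X : Type*} [NonUnitalCStarAlgebra A]
    [NormedAddCommGroup X] [NormedSpace ℂ X] [CompleteSpace X]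
    (j : A ≃ₗᵢ[ℂ] StrongDual ℂ X) (a : A) :
    Continuous[wStarTopology j, wStarTopology j] (fun x : A => a * x) ∧
      Continuous[wStarTopology j, wStarTopology j] (fun x : A => x * a) :=
  ⟨continuous_wStarTopology_of_forall_exists_predual j (exists_predual_mul_left j a),
    continuous_wStarTopology_of_forall_exists_predual j (exists_predual_mul_right j a)⟩
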